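/- Let $n\ge 0$ and let $(M,\varphi,\xi,\eta,g)$ be a contact metric manifold of dimension $2n+1$; that is, $M$ is a smooth manifold with a smooth Riemannian metric $g$, a smooth $(1,1)$-tensor field $\varphi$, a smooth vector field $\xi$ and a smooth $1$-form $\eta$ such that, for all vector fields $X,Y$, $$\varphi^2=-\mathrm{Id}+\eta\otimes\xi,\qquad \eta(\xi)=1,\qquad g(\varphi X,\varphi Y)=g(X,Y)-\eta(X)\eta(Y),\qquad d\eta(X,Y)=g(X,\varphi Y),$$ where $d\eta(X,Y)=\tfrac12\bigl(X\eta(Y)-Y\eta(X)-\eta([X,Y])\bigr)$. Let $\nabla$ be the Levi-Civita connection of $g$, $R_{XY}Z=\nabla_X\nabla_YZ-\nabla_Y\nabla_XZ-\nabla_{[X,Y]}Z$, $R(X,Y,Z,W)=-g(R_{XY}Z,W)$, and $\mathrm{Ric}(Y,Z)=\mathrm{tr}(X\mapsto R_{XY}Z)$. Suppose that $M$ satisfies the $(G3)$ identity $$R(X,Y,Z,W)=R(\varphi X,\varphi Y,\varphi Z,\varphi W)+g(X,Z)\eta(W)\eta(Y)-g(Z,Y)\eta(X)\eta(W)+g(Y,W)\eta(X)\eta(Z)-g(X,W)\eta(Y)\eta(Z)$$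 for all smooth vector fields $X,Y,Z,W$ on $M$. Then $\mathrm{Ric}(\xi,\xi)=2n$ on $M$, and $M$ is K-contact, i.e. $\xi$ is a Killing vector field: $\mathcal L_\xi g=0$. -/

import Mathlib

open Bundle VectorField
open scoped Manifold ContDiff Topology

noncomputable section

namespace ContactGeometry

set_option linter.unusedSectionVars false

variable {E : Type*} [NormedAddCommGroup E] [NormedSpace ℝ E] [FiniteDimensional ℝ E]
  {H : Type*} [TopologicalSpace H] (I : ModelWithCorners ℝ E H)
  {M : Type*} [TopologicalSpace M] [ChartedSpace H M] [IsManifold I ∞ M]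
  [RiemannianBundle (fun x : M ↦ TangentSpace I x)]
  [IsContMDiffRiemannianBundle I ∞ E (fun x : M ↦ TangentSpace I x)]

/-! ### The Levi-Civita connection

Mathlib has connections on the tangent bundle, their torsion and their compatibility with a
Riemannian metric, but not the Levi-Civita connection. It is constructed here from the Koszul
formula, and shown to be torsion-free and metric. The metric `g` is the `inner` given by the
`RiemannianBundle` structure on the tangent bundle. -/

/-- The right-hand side of the Koszul formula for `g(∇_X Y, Z)`. -/
def koszul (X Y Z : Π x : M, TangentSpace I x) (x : M) : ℝ :=
  (1 / 2) *
    (mvfderiv I (fun y ↦ inner ℝ (Y y) (Z y)) x (X x)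
      + mvfderiv I (fun y ↦ inner ℝ (X y) (Z y)) x (Y x)
      - mvfderiv I (fun y ↦ inner ℝ (X y) (Y y)) x (Z x)
      + inner ℝ (mlieBracket I X Y x) (Z x)
      - inner ℝ (mlieBracket I X Z x) (Y x)
      - inner ℝ (mlieBracket I Y Z x) (X x))

variable {I}

lemma mdifferentiableAt_inner {X Y : Π x : M, TangentSpace I x} {x : M}
    (hX : MDiffAt (T% X) x) (hY : MDiffAt (T% Y) x) :
    MDiffAt (fun y ↦ (inner ℝ (X y) (Y y) : ℝ)) x :=
  MDifferentiableAt.inner_bundle (F := E) (E := fun x : M ↦ TangentSpace I x)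
    (b := fun y : M ↦ y) hX hY

lemma mvfderiv_inner_smul_left {f : M → ℝ} {X Y : Π x : M, TangentSpace I x} {x : M}
    (hf : MDiffAt f x) (hX : MDiffAt (T% X) x) (hY : MDiffAt (T% Y) x) (v : TangentSpace I x) :
    mvfderiv I (fun y ↦ (inner ℝ ((f • X) y) (Y y) : ℝ)) x v =
      f x * mvfderiv I (fun y ↦ (inner ℝ (X y) (Y y) : ℝ)) x v
        + inner ℝ (X x) (Y x) * mvfderiv I f x v := by
  have h : (fun y ↦ (inner ℝ ((f • X) y) (Y y) : ℝ)) =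
      fun y ↦ f y * (inner ℝ (X y) (Y y) : ℝ) := by
    funext y
    exact real_inner_smul_left _ _ _
  rw [h, mvfderiv_fun_mul hf (mdifferentiableAt_inner hX hY)]
  simp

lemma mvfderiv_inner_smul_right {f : M → ℝ} {X Y : Π x : M, TangentSpace I x} {x : M}
    (hf : MDiffAt f x) (hX : MDiffAt (T% X) x) (hY : MDiffAt (T% Y) x) (v : TangentSpace I x) :
    mvfderiv I (fun y ↦ (inner ℝ (X y) ((f • Y) y) : ℝ)) x v =
      f x * mvfderiv I (fun y ↦ (inner ℝ (X y) (Y y) : ℝ)) x v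
        + inner ℝ (X x) (Y x) * mvfderiv I f x v := by
  have h : (fun y ↦ (inner ℝ (X y) ((f • Y) y) : ℝ)) =
      fun y ↦ f y * (inner ℝ (X y) (Y y) : ℝ) := by
    funext y
    exact real_inner_smul_right _ _ _
  rw [h, mvfderiv_fun_mul hf (mdifferentiableAt_inner hX hY)]
  simp

lemma mvfderiv_inner_add_left {X X' Y : Π x : M, TangentSpace I x} {x : M}
    (hX : MDiffAt (T% X) x) (hX' : MDiffAt (T% X') x) (hY : MDiffAt (T% Y) x)
    (v : TangentSpace I x) :
    mvfderiv I (fun y ↦ (inner ℝ ((X + X') y) (Y y) : ℝ)) x v =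
      mvfderiv I (fun y ↦ (inner ℝ (X y) (Y y) : ℝ)) x v
        + mvfderiv I (fun y ↦ (inner ℝ (X' y) (Y y) : ℝ)) x v := by
  have h : (fun y ↦ (inner ℝ ((X + X') y) (Y y) : ℝ)) =
      fun y ↦ (inner ℝ (X y) (Y y) : ℝ) + (inner ℝ (X' y) (Y y) : ℝ) := by
    funext y
    exact inner_add_left _ _ _
  rw [h, mvfderiv_fun_add (mdifferentiableAt_inner hX hY) (mdifferentiableAt_inner hX' hY)]
  simp

lemma mvfderiv_inner_add_right {X Y Y' : Π x : M, TangentSpace I x} {x : M}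
    (hX : MDiffAt (T% X) x) (hY : MDiffAt (T% Y) x) (hY' : MDiffAt (T% Y') x)
    (v : TangentSpace I x) :
    mvfderiv I (fun y ↦ (inner ℝ (X y) ((Y + Y') y) : ℝ)) x v =
      mvfderiv I (fun y ↦ (inner ℝ (X y) (Y y) : ℝ)) x v
        + mvfderiv I (fun y ↦ (inner ℝ (X y) (Y' y) : ℝ)) x v := by
  have h : (fun y ↦ (inner ℝ (X y) ((Y + Y') y) : ℝ)) =
      fun y ↦ (inner ℝ (X y) (Y y) : ℝ) + (inner ℝ (X y) (Y' y) : ℝ) := by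
    funext y
    exact inner_add_right _ _ _
  rw [h, mvfderiv_fun_add (mdifferentiableAt_inner hX hY) (mdifferentiableAt_inner hX hY')]
  simp

lemma koszul_tensorial_left {Y Z : Π x : M, TangentSpace I x} {x : M}
    (hY : MDiffAt (T% Y) x) (hZ : MDiffAt (T% Z) x) :
    TensorialAt I E (fun X ↦ koszul I X Y Z x) x where
  smul {f X} hf hX := by
    simp only [koszul, mvfderiv_inner_smul_left hf hX hY, mvfderiv_inner_smul_left hf hX hZ,
      mlieBracket_smul_left hf hX]
    simp only [Pi.smul_apply', inner_add_left, real_inner_smul_left, real_inner_smul_right,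
      map_smul, smul_eq_mul]
    ring
  add {X X'} hX hX' := by
    simp only [koszul, mvfderiv_inner_add_left hX hX' hY, mvfderiv_inner_add_left hX hX' hZ,
      mlieBracket_add_left hX hX']
    simp only [Pi.add_apply, inner_add_left, inner_add_right, map_add]
    ring

lemma koszul_tensorial_right {X Y : Π x : M, TangentSpace I x} {x : M}
    (hX : MDiffAt (T% X) x) (hY : MDiffAt (T% Y) x) :
    TensorialAt I E (fun Z ↦ koszul I X Y Z x) x where
  smul {f Z} hf hZ := by
    simp only [koszul, mvfderiv_inner_smul_right hf hY hZ, mvfderiv_inner_smul_right hf hX hZ,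
      mlieBracket_smul_right hf hZ]
    simp only [Pi.smul_apply', inner_add_left, real_inner_smul_left, real_inner_smul_right,
      map_smul, smul_eq_mul, real_inner_comm (Z x) (X x), real_inner_comm (Z x) (Y x)]
    ring
  add {Z Z'} hZ hZ' := by
    simp only [koszul, mvfderiv_inner_add_right hY hZ hZ', mvfderiv_inner_add_right hX hZ hZ',
      mlieBracket_add_right hZ hZ']
    simp only [Pi.add_apply, inner_add_left, inner_add_right, map_add]
    ring

lemma koszul_add_middle {X Y Y' Z : Π x : M, TangentSpace I x} {x : M}
    (hX : MDiffAt (T% X) x) (hY : MDiffAt (T% Y) x) (hY' : MDiffAt (T% Y') x)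
    (hZ : MDiffAt (T% Z) x) :
    koszul I X (Y + Y') Z x = koszul I X Y Z x + koszul I X Y' Z x := by
  simp only [koszul, mvfderiv_inner_add_left hY hY' hZ, mvfderiv_inner_add_right hX hY hY',
    mlieBracket_add_left hY hY', mlieBracket_add_right hY hY']
  simp only [Pi.add_apply, inner_add_left, inner_add_right, map_add]
  ring

lemma koszul_smul_middle {f : M → ℝ} {X Y Z : Π x : M, TangentSpace I x} {x : M}
    (hf : MDiffAt f x) (hX : MDiffAt (T% X) x) (hY : MDiffAt (T% Y) x) (hZ : MDiffAt (T% Z) x) :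
    koszul I X (f • Y) Z x =
      f x * koszul I X Y Z x + mvfderiv I f x (X x) * inner ℝ (Y x) (Z x) := by
  simp only [koszul, mvfderiv_inner_smul_left hf hY hZ, mvfderiv_inner_smul_right hf hX hY,
    mlieBracket_smul_left hf hY, mlieBracket_smul_right hf hY]
  simp only [Pi.smul_apply', inner_add_left, real_inner_smul_left, real_inner_smul_right,
    map_smul, smul_eq_mul, real_inner_comm (X x) (Y x)]
  ring

instance finiteDimensional_tangentSpace (x : M) : FiniteDimensional ℝ (TangentSpace I x) :=
  inferInstanceAs (FiniteDimensional ℝ E)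

instance completeSpace_tangentSpace (x : M) : CompleteSpace (TangentSpace I x) :=
  FiniteDimensional.complete ℝ (TangentSpace I x)

/-- For `Y` differentiable at `x`, the bilinear form `(v, w) ↦ g(∇_v Y, w)` on `T_x M`. -/
def koszulForm {Y : Π x : M, TangentSpace I x} {x : M} (hY : MDiffAt (T% Y) x) :
    TangentSpace I x →L[ℝ] TangentSpace I x →L[ℝ] ℝ :=
  TensorialAt.mkHom₂ (fun X Z ↦ koszul I X Y Z x) x
    (fun _ hZ ↦ koszul_tensorial_left hY hZ) (fun _ hX ↦ koszul_tensorial_right hX hY)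

lemma koszulForm_apply {X Y Z : Π x : M, TangentSpace I x} {x : M}
    (hX : MDiffAt (T% X) x) (hY : MDiffAt (T% Y) x) (hZ : MDiffAt (T% Z) x) :
    koszulForm hY (X x) (Z x) = koszul I X Y Z x :=
  TensorialAt.mkHom₂_apply _ _ hX hZ

open Classical in
/-- The map `v ↦ ∇_v Y` on `T_x M`, obtained by raising an index in the Koszul formula. Where `Y`
is not differentiable the value is `0`. -/
def leviCivitaFun (Y : Π x : M, TangentSpace I x) (x : M) :
    TangentSpace I x →L[ℝ] TangentSpace I x :=
  if hY : MDiffAt (T% Y) x then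
    LinearMap.toContinuousLinearMap
      { toFun := fun v ↦ (InnerProductSpace.toDual ℝ (TangentSpace I x)).symm (koszulForm hY v)
        map_add' := fun v w ↦ by simp
        map_smul' := fun c v ↦ by simp }
  else 0

lemma inner_leviCivitaFun {X Y Z : Π x : M, TangentSpace I x} {x : M}
    (hX : MDiffAt (T% X) x) (hY : MDiffAt (T% Y) x) (hZ : MDiffAt (T% Z) x) :
    inner ℝ (leviCivitaFun Y x (X x)) (Z x) = koszul I X Y Z x := by
  rw [← koszulForm_apply hX hY hZ, leviCivitaFun, dif_pos hY]
  exact InnerProductSpace.toDual_symm_apply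

lemma ext_of_inner_fields {x : M} {A B : TangentSpace I x →L[ℝ] TangentSpace I x}
    (h : ∀ X Z : Π x : M, TangentSpace I x, MDiffAt (T% X) x → MDiffAt (T% Z) x →
      (inner ℝ (A (X x)) (Z x) : ℝ) = inner ℝ (B (X x)) (Z x)) : A = B := by
  ext v
  refine ext_inner_right ℝ fun w ↦ ?_
  have := h (FiberBundle.extend E v) (FiberBundle.extend E w)
    (FiberBundle.mdifferentiableAt_extend ..) (FiberBundle.mdifferentiableAt_extend ..)
  simpa using this

variable (I M) in
/-- The Levi-Civita connection of a Riemannian manifold; `leviCivita I M Y x v` is `∇_v Y`. -/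
def leviCivita : CovariantDerivative I E (fun x : M ↦ TangentSpace I x) where
  toFun := leviCivitaFun
  isCovariantDerivativeOnUniv :=
    { add := fun {Y Y' x} hY hY' _ ↦ by
        refine ext_of_inner_fields fun X Z hX hZ ↦ ?_
        rw [inner_leviCivitaFun hX (mdifferentiableAt_add_section hY hY') hZ,
          koszul_add_middle hX hY hY' hZ, add_apply, inner_add_left,
          inner_leviCivitaFun hX hY hZ, inner_leviCivitaFun hX hY' hZ]
      leibniz := fun {Y f x} hY hf _ ↦ by
        refine ext_of_inner_fields fun X Z hX hZ ↦ ?_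
        rw [inner_leviCivitaFun hX (hf.smul_section hY) hZ, koszul_smul_middle hf hX hY hZ,
          add_apply, inner_add_left, smul_apply,
          real_inner_smul_left, inner_leviCivitaFun hX hY hZ,
          ContinuousLinearMap.smulRight_apply, real_inner_smul_left] }

theorem inner_leviCivita {X Y Z : Π x : M, TangentSpace I x} {x : M}
    (hX : MDiffAt (T% X) x) (hY : MDiffAt (T% Y) x) (hZ : MDiffAt (T% Z) x) :
    inner ℝ (leviCivita I M Y x (X x)) (Z x) = koszul I X Y Z x :=
  inner_leviCivitaFun hX hY hZ

/-- The Levi-Civita connection is torsion-free: `∇_X Y - ∇_Y X = [X, Y]`. -/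
theorem leviCivita_torsion_free {X Y : Π x : M, TangentSpace I x} {x : M}
    (hX : MDiffAt (T% X) x) (hY : MDiffAt (T% Y) x) :
    leviCivita I M Y x (X x) - leviCivita I M X x (Y x) = mlieBracket I X Y x := by
  refine ext_inner_right ℝ fun w ↦ ?_
  have hZ : MDiffAt (T% (FiberBundle.extend E w)) x := FiberBundle.mdifferentiableAt_extend ..
  rw [← FiberBundle.extend_apply_self (F := E) w, inner_sub_left, inner_leviCivita hX hY hZ,
    inner_leviCivita hY hX hZ, koszul, koszul, mlieBracket_swap_apply (V := Y) (W := X)]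
  simp only [inner_neg_left, real_inner_comm]
  ring

/-- The Levi-Civita connection is metric: `X g(Y, Z) = g(∇_X Y, Z) + g(Y, ∇_X Z)`. -/
theorem leviCivita_metric {X Y Z : Π x : M, TangentSpace I x} {x : M}
    (hX : MDiffAt (T% X) x) (hY : MDiffAt (T% Y) x) (hZ : MDiffAt (T% Z) x) :
    mvfderiv I (fun y ↦ (inner ℝ (Y y) (Z y) : ℝ)) x (X x) =
      inner ℝ (leviCivita I M Y x (X x)) (Z x) + inner ℝ (Y x) (leviCivita I M Z x (X x)) := by
  have h1 := inner_leviCivita hX hY hZ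
  have h2 := inner_leviCivita hX hZ hY
  rw [h1, real_inner_comm, h2, koszul, koszul, mlieBracket_swap_apply (V := Z) (W := Y)]
  simp only [inner_neg_left, real_inner_comm]
  ring

/-! ### Curvature -/

variable (I)

/-- Smooth vector fields on `M`. -/
def IsSmoothField (X : Π x : M, TangentSpace I x) : Prop :=
  ContMDiff I I.tangent ∞ (fun x ↦ (⟨x, X x⟩ : TangentBundle I M))

/-- The vector field `∇_X Y` for the Levi-Civita connection `∇`. -/
def nabla (X Y : Π x : M, TangentSpace I x) : Π x : M, TangentSpace I x :=
  fun x ↦ leviCivita I M Y x (X x)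

/-- The curvature tensor `R_{XY} Z = ∇_X ∇_Y Z - ∇_Y ∇_X Z - ∇_{[X, Y]} Z`. -/
def curvature (X Y Z : Π x : M, TangentSpace I x) : Π x : M, TangentSpace I x :=
  nabla I X (nabla I Y Z) - nabla I Y (nabla I X Z) - nabla I (mlieBracket I X Y) Z

/-- The Riemann-Christoffel curvature tensor, with the sign `R(X, Y, Z, W) = -g(R_{XY} Z, W)`. -/
def riemannTensor (X Y Z W : Π x : M, TangentSpace I x) (x : M) : ℝ :=
  -inner ℝ (curvature I X Y Z x) (W x)

/-- The Ricci tensor `Ric(Y, Z)` at `x`, the trace of `v ↦ R_{vY} Z` on `T_x M`, computed in an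
orthonormal basis of `T_x M`. Each basis vector is extended to a vector field, smooth near `x`,
by `FiberBundle.extend`; since `R_{XY} Z` is tensorial in `X`, the extension does not matter. -/
def ricci (Y Z : Π x : M, TangentSpace I x) (x : M) : ℝ :=
  ∑ i, inner ℝ
    (curvature I (FiberBundle.extend E (stdOrthonormalBasis ℝ (TangentSpace I x) i)) Y Z x)
    (stdOrthonormalBasis ℝ (TangentSpace I x) i)

/-! ### Contact metric structures -/

/-- The exterior derivative of a one-form, with the normalization
`dη(X, Y) = (1/2) (X η(Y) - Y η(X) - η([X, Y]))`. -/
def oneFormDeriv (η : Π x : M, TangentSpace I x →L[ℝ] ℝ) (X Y : Π x : M, TangentSpace I x)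
    (x : M) : ℝ :=
  (1 / 2) *
    (mvfderiv I (fun y ↦ η y (Y y)) x (X x) - mvfderiv I (fun y ↦ η y (X y)) x (Y x)
      - η x (mlieBracket I X Y x))

/-- The Lie derivative of the metric,
`(L_ξ g)(X, Y) = ξ g(X, Y) - g([ξ, X], Y) - g(X, [ξ, Y])`. -/
def lieDerivMetric (ξ X Y : Π x : M, TangentSpace I x) (x : M) : ℝ :=
  mvfderiv I (fun y ↦ (inner ℝ (X y) (Y y) : ℝ)) x (ξ x)
    - inner ℝ (mlieBracket I ξ X x) (Y x) - inner ℝ (X x) (mlieBracket I ξ Y x)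

/-- `ξ` is a Killing vector field: `L_ξ g = 0`. -/
def IsKilling (ξ : Π x : M, TangentSpace I x) : Prop :=
  ∀ X Y : Π x : M, TangentSpace I x, IsSmoothField I X → IsSmoothField I Y →
    ∀ x, lieDerivMetric I ξ X Y x = 0

/-- `(φ, ξ, η, g)` is an almost contact metric structure on `M`: `φ` is a smooth `(1,1)`-tensor
field, `ξ` a smooth vector field and `η` a smooth one-form, with `φ² = -Id + η ⊗ ξ`, `η(ξ) = 1`
and `g(φ X, φ Y) = g(X, Y) - η(X) η(Y)`. -/
structure IsAlmostContactMetric (φ : Π x : M, TangentSpace I x →L[ℝ] TangentSpace I x)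
    (ξ : Π x : M, TangentSpace I x) (η : Π x : M, TangentSpace I x →L[ℝ] ℝ) : Prop where
  smooth_phi : ContMDiff I (I.prod 𝓘(ℝ, E →L[ℝ] E)) ∞
    (fun x ↦ TotalSpace.mk' (E →L[ℝ] E)
      (E := fun x : M ↦ TangentSpace I x →L[ℝ] TangentSpace I x) x (φ x))
  smooth_xi : IsSmoothField I ξ
  smooth_eta : ContMDiff I (I.prod 𝓘(ℝ, E →L[ℝ] ℝ)) ∞
    (fun x ↦ TotalSpace.mk' (E →L[ℝ] ℝ) (E := fun x : M ↦ TangentSpace I x →L[ℝ] ℝ) x (η x))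
  phi_sq : ∀ (x : M) (v : TangentSpace I x), φ x (φ x v) = -v + η x v • ξ x
  eta_xi : ∀ x : M, η x (ξ x) = 1
  inner_phi : ∀ (x : M) (v w : TangentSpace I x),
    (inner ℝ (φ x v) (φ x w) : ℝ) = inner ℝ v w - η x v * η x w

/-- `(φ, ξ, η, g)` is a contact metric structure on `M`: an almost contact metric structure with
`dη(X, Y) = g(X, φ Y)`. As this two-form is nondegenerate on `ker η`, such an `η` is a contact
form. -/
structure IsContactMetric (φ : Π x : M, TangentSpace I x →L[ℝ] TangentSpace I x)
    (ξ : Π x : M, TangentSpace I x) (η : Π x : M, TangentSpace I x →L[ℝ] ℝ) : Prop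
    extends IsAlmostContactMetric I φ ξ η where
  deriv_eta : ∀ X Y : Π x : M, TangentSpace I x, IsSmoothField I X → IsSmoothField I Y →
    ∀ x, oneFormDeriv I η X Y x = inner ℝ (X x) (φ x (Y x))

/-- A K-contact structure is a contact metric structure whose field `ξ` is Killing. -/
structure IsKContact (φ : Π x : M, TangentSpace I x →L[ℝ] TangentSpace I x)
    (ξ : Π x : M, TangentSpace I x) (η : Π x : M, TangentSpace I x →L[ℝ] ℝ) : Prop
    extends IsContactMetric I φ ξ η where
  isKilling : IsKilling I ξ

/-- The `(G3)` curvature identity of an almost contact metric structure. -/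
def SatisfiesG3 (φ : Π x : M, TangentSpace I x →L[ℝ] TangentSpace I x)
    (η : Π x : M, TangentSpace I x →L[ℝ] ℝ) : Prop :=
  ∀ X Y Z W : Π x : M, TangentSpace I x,
    IsSmoothField I X → IsSmoothField I Y → IsSmoothField I Z → IsSmoothField I W → ∀ x : M,
      riemannTensor I X Y Z W x =
        riemannTensor I (fun y ↦ φ y (X y)) (fun y ↦ φ y (Y y)) (fun y ↦ φ y (Z y))
            (fun y ↦ φ y (W y)) x
          + inner ℝ (X x) (Z x) * η x (W x) * η x (Y x)
          - inner ℝ (Z x) (Y x) * η x (X x) * η x (W x)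
          + inner ℝ (Y x) (W x) * η x (X x) * η x (Z x)
          - inner ℝ (X x) (W x) * η x (Y x) * η x (Z x)

end ContactGeometry

end

noncomputable section

namespace ContactGeometry

set_option linter.unusedSectionVars false

/-! ### Linear algebra of a contact metric structure at a point -/

section LinearAlgebra

variable {V : Type*} [NormedAddCommGroup V] [InnerProductSpace ℝ V] {φ A S : V →L[ℝ] V} {ξ : V}
  {η : V →L[ℝ] ℝ}

/-- An almost contact metric structure on an inner product space. -/
structure IsAlmostContactLinear (φ : V →L[ℝ] V) (ξ : V) (η : V →L[ℝ] ℝ) : Prop where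
  phi_sq : ∀ v, φ (φ v) = -v + η v • ξ
  eta_xi : η ξ = 1
  inner_phi : ∀ v w, (inner ℝ (φ v) (φ w) : ℝ) = inner ℝ v w - η v * η w

namespace IsAlmostContactLinear

lemma phi_xi (h : IsAlmostContactLinear φ ξ η) : φ ξ = 0 := by
  have h2 : φ (φ ξ) = 0 := by simp [h.phi_sq, h.eta_xi]
  have h3 : φ ξ = η (φ ξ) • ξ := by
    have := h.phi_sq (φ ξ)
    rw [h2, map_zero] at this
    exact (neg_add_eq_zero.1 this.symm)
  have h4 : η (φ ξ) * η (φ ξ) = 0 := by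
    have := congrArg η h2
    rw [h3, map_smul, map_smul, map_zero, smul_eq_mul] at this
    simpa [h.eta_xi] using this
  rw [h3, mul_self_eq_zero.1 h4, zero_smul]

lemma eta_eq_inner (h : IsAlmostContactLinear φ ξ η) (v : V) : η v = inner ℝ v ξ := by
  have := h.inner_phi v ξ
  rw [h.phi_xi, inner_zero_right, h.eta_xi] at this
  linarith

lemma eta_phi (h : IsAlmostContactLinear φ ξ η) (v : V) : η (φ v) = 0 := by
  have h1 := h.phi_sq (φ v)
  rw [h.phi_sq v, map_add, map_neg, map_smul, h.phi_xi, smul_zero, add_zero] at h1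
  have h2 := congrArg η (left_eq_add.1 h1)
  simpa [h.eta_xi] using h2

lemma phi_phi_phi (h : IsAlmostContactLinear φ ξ η) (v : V) : φ (φ (φ v)) = -φ v := by
  rw [h.phi_sq, h.eta_phi, zero_smul, add_zero]

lemma inner_phi_left (h : IsAlmostContactLinear φ ξ η) (v w : V) :
    (inner ℝ (φ v) w : ℝ) = -inner ℝ v (φ w) := by
  have h1 := h.inner_phi v (φ w)
  rw [h.phi_sq, h.eta_phi, inner_add_right, inner_neg_right, inner_smul_right, ← h.eta_eq_inner,
    h.eta_phi] at h1
  linarith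

lemma inner_phi_phi_left (h : IsAlmostContactLinear φ ξ η) (v w : V) :
    (inner ℝ (φ (φ v)) w : ℝ) = inner ℝ v (φ (φ w)) := by
  rw [h.inner_phi_left, h.inner_phi_left, neg_neg]

lemma eq_zero_of_phi_eq_zero (h : IsAlmostContactLinear φ ξ η) {v : V} (hv : φ v = 0)
    (hv' : η v = 0) : v = 0 := by
  simpa [hv, hv'] using h.phi_sq v

/-- If `S` is the symmetric part of `A`, whose skew part is `-φ`, then the skew part of `A²` is
`-(Sφ + φS)`. -/
lemma eq_neg_anticommutator (h : IsAlmostContactLinear φ ξ η)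
    (hS : ∀ v w, (inner ℝ (S v) w : ℝ) = inner ℝ v (S w)) (hA : ∀ v, A v = S v - φ v) {d y : V}
    (hd : ∀ v, 2 * (inner ℝ v d : ℝ) = inner ℝ (A (A y)) v - inner ℝ (A (A v)) y) :
    d = -(S (φ y) + φ (S y)) := by
  refine ext_inner_left ℝ fun v ↦ ?_
  have hadj : ∀ u w, (inner ℝ (A u) w : ℝ) = inner ℝ u (S w + φ w) := fun u w ↦ by
    rw [hA, inner_sub_left, hS, h.inner_phi_left, inner_add_right, sub_neg_eq_add]
  have h1 := hd v
  rw [hadj (A v), hadj v, real_inner_comm v (A (A y))] at h1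
  simp only [hA, map_sub, map_add, inner_add_right, inner_sub_right] at h1
  rw [inner_neg_right, inner_add_right]
  linarith

/-- A symmetric `S` with `Sξ = 0` whose anticommutator with `φ` itself anticommutes with `φ` must
anticommute with `φ`. -/
lemma anticommutator_eq_zero (h : IsAlmostContactLinear φ ξ η)
    (hS : ∀ v w, (inner ℝ (S v) w : ℝ) = inner ℝ v (S w)) (hξ : S ξ = 0)
    (hT : ∀ y, S (φ (φ y)) + φ (S (φ y)) = -φ (S (φ y) + φ (S y))) (y : V) :
    S (φ y) + φ (S y) = 0 := by
  have hη : ∀ v, η (S v) = 0 := fun v ↦ by rw [h.eta_eq_inner, hS, hξ, inner_zero_right]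
  refine h.eq_zero_of_phi_eq_zero ?_ (by rw [map_add, hη, h.eta_phi, add_zero])
  have h1 := hT y
  rw [map_add, h.phi_sq y, h.phi_sq (S y), hη, map_add, map_neg, map_smul, hξ, smul_zero,
    zero_smul, add_zero] at h1
  rw [map_add, h.phi_sq (S y), hη, zero_smul, add_zero]
  have h2 : (2 : ℝ) • (φ (S (φ y)) + -S y) = 0 := by
    rw [two_smul]
    nth_rewrite 1 [add_comm (φ (S (φ y)))]
    rw [h1, neg_add_cancel]
  exact (smul_eq_zero.1 h2).resolve_left two_ne_zero

lemma symmetricPart_eq_zero (h : IsAlmostContactLinear φ ξ η)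
    (hS : ∀ v w, (inner ℝ (S v) w : ℝ) = inner ℝ v (S w)) (hξ : S ξ = 0)
    (hA : ∀ v, A v = S v - φ v) (hT : ∀ y, S (φ y) + φ (S y) = 0)
    (hA2 : ∀ y, A (A (φ y)) + φ (A (A y)) = -(2 : ℝ) • φ y) (y : V) : S y = 0 := by
  have hsq : ∀ v, A (A v) = S (S v) + φ (φ v) := fun v ↦ by
    have h0 : A (A v) = S (S v) + φ (φ v) - (S (φ v) + φ (S v)) := by
      simp only [hA, map_sub]
      abel
    rw [h0, hT, sub_zero]
  have hcomm : ∀ v, S (φ v) = -φ (S v) := fun v ↦ eq_neg_of_add_eq_zero_left (hT v)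
  have h1 := hA2 y
  rw [hsq, hsq, map_add, h.phi_phi_phi, hcomm, map_neg, hcomm, neg_neg] at h1
  have h2 : φ (S (S y)) = 0 := by
    have h0 : (2 : ℝ) • φ (S (S y)) =
        φ (S (S y)) + -φ y + (φ (S (S y)) + -φ y) - -(2 : ℝ) • φ y := by module
    rw [h1, sub_self] at h0
    simpa using h0
  have h3 : S (S y) = 0 := h.eq_zero_of_phi_eq_zero h2
    (by rw [h.eta_eq_inner, hS, hξ, inner_zero_right])
  rw [← inner_self_eq_zero (𝕜 := ℝ), hS, h3, inner_zero_right]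

end IsAlmostContactLinear

end LinearAlgebra

variable {E : Type*} [NormedAddCommGroup E] [NormedSpace ℝ E] [FiniteDimensional ℝ E]
  {H : Type*} [TopologicalSpace H] {I : ModelWithCorners ℝ E H}
  {M : Type*} [TopologicalSpace M] [ChartedSpace H M] [IsManifold I ∞ M]
  [RiemannianBundle (fun x : M ↦ TangentSpace I x)]
  [IsContMDiffRiemannianBundle I ∞ E (fun x : M ↦ TangentSpace I x)]

/-! ### Smoothness of the Levi-Civita connection -/

lemma contMDiffAt_matrix_det {ι : Type*} [Fintype ι] [DecidableEq ι] {A : M → Matrix ι ι ℝ}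
    {x : M} (hA : ∀ i j, ContMDiffAt I 𝓘(ℝ) ∞ (fun y ↦ A y i j) x) :
    ContMDiffAt I 𝓘(ℝ) ∞ (fun y ↦ (A y).det) x := by
  simp only [Matrix.det_apply']
  refine ContMDiffAt.sum fun σ _ ↦ ?_
  have h : ContMDiffAt I 𝓘(ℝ) ∞ (fun y ↦ ∏ i, A y (σ i) i) x :=
    ContMDiffAt.prod fun i _ ↦ hA _ _
  exact (contMDiffAt_const (c := ((σ.sign : ℤ) : ℝ))).mul h

lemma contMDiffAt_inner {X Y : Π x : M, TangentSpace I x} {x : M}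
    (hX : CMDiffAt ∞ (T% X) x) (hY : CMDiffAt ∞ (T% Y) x) :
    ContMDiffAt I 𝓘(ℝ) ∞ (fun y ↦ (inner ℝ (X y) (Y y) : ℝ)) x :=
  ContMDiffAt.inner_bundle (F := E) (E := fun x : M ↦ TangentSpace I x)
    (b := fun y : M ↦ y) hX hY

/-- A vector field is smooth at `x` as soon as its scalar products with all vector fields smooth
at `x` are. -/
lemma contMDiffAt_of_inner {V : Π x : M, TangentSpace I x} {x : M}
    (h : ∀ Z : Π x : M, TangentSpace I x, CMDiffAt ∞ (T% Z) x →
      ContMDiffAt I 𝓘(ℝ) ∞ (fun y ↦ (inner ℝ (Z y) (V y) : ℝ)) x) :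
    CMDiffAt ∞ (T% V) x := by
  classical
  set e := trivializationAt E (fun x : M ↦ TangentSpace I x) x
  have hx : x ∈ e.baseSet := FiberBundle.mem_baseSet_trivializationAt' x
  have hu : e.baseSet ∈ 𝓝 x := e.open_baseSet.mem_nhds hx
  let b := Module.finBasis ℝ E
  have hs : IsLocalFrameOn I E ∞ (e.localFrame b) e.baseSet :=
    e.isLocalFrameOn_localFrame_baseSet I ∞ b
  have he : ∀ i, CMDiffAt ∞ (T% (e.localFrame b i)) x := fun i ↦ (hs.contMDiffOn i).contMDiffAt hu
  let G : M → Matrix _ _ ℝ := fun y ↦ Matrix.gram ℝ fun i ↦ e.localFrame b i y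
  have hG : ∀ i j, ContMDiffAt I 𝓘(ℝ) ∞ (fun y ↦ G y i j) x := fun i j ↦ contMDiffAt_inner (he i) (he j)
  have hdet : ∀ y ∈ e.baseSet, (G y).det ≠ 0 := fun y hy ↦
    Matrix.det_gram_ne_zero_iff_linearIndependent.2 (hs.linearIndependent hy)
  refine hs.contMDiffAt_of_coeff (fun j ↦ ?_) hu
  have key : ContMDiffAt I 𝓘(ℝ) ∞
      (fun y ↦ ((G y).updateCol j fun i ↦ inner ℝ (e.localFrame b i y) (V y)).det / (G y).det) x := by
    refine ContMDiffAt.div₀ (contMDiffAt_matrix_det fun i k ↦ ?_) (contMDiffAt_matrix_det hG)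
      (hdet x hx)
    simp only [Matrix.updateCol_apply]
    split_ifs
    · exact h _ (he i)
    · exact hG i k
  refine key.congr_of_eventuallyEq (Filter.eventually_of_mem hu fun y hy ↦ ?_)
  let c := fun k ↦ hs.coeff k y (V y)
  have hV : (fun i ↦ (inner ℝ (e.localFrame b i y) (V y) : ℝ)) = (G y).mulVec c := by
    funext i
    conv_lhs => rw [hs.coeff_sum_eq V hy]
    simp [Matrix.mulVec, dotProduct, G, inner_sum, real_inner_smul_right, c, mul_comm]
  change c j = ((G y).updateCol j fun i ↦ inner ℝ (e.localFrame b i y) (V y)).det / (G y).det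
  rw [hV, ← Matrix.cramer_apply, Matrix.cramer_eq_adjugate_mulVec, Matrix.mulVec_mulVec,
    Matrix.adjugate_mul, Matrix.smul_mulVec, Matrix.one_mulVec, Pi.smul_apply, smul_eq_mul,
    mul_div_cancel_left₀ _ (hdet y hy)]

lemma contMDiffAt_mvfderiv_apply {f : M → ℝ} {X : Π x : M, TangentSpace I x} {x : M}
    (hf : ContMDiffAt I 𝓘(ℝ) ∞ f x) (hX : CMDiffAt ∞ (T% X) x) :
    ContMDiffAt I 𝓘(ℝ) ∞ (fun y ↦ mvfderiv I f y (X y)) x := by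
  have h := ContMDiffAt.clm_apply_of_inCoordinates (hf.mfderiv_const (m := ∞) (by simp)) hX hf
  have h' := (contMDiffAt_totalSpace.1 h).2
  simp only [trivializationAt_model_space_apply] at h'
  exact h'

lemma contMDiffAt_mlieBracket {X Y : Π x : M, TangentSpace I x} {x : M}
    (hX : CMDiffAt ∞ (T% X) x) (hY : CMDiffAt ∞ (T% Y) x) :
    CMDiffAt ∞ (T% (mlieBracket I X Y)) x := by
  have : CompleteSpace E := FiniteDimensional.complete ℝ E
  have : IsManifold I (minSmoothness ℝ 2) M := by
    rw [minSmoothness_of_isRCLikeNormedField]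
    infer_instance
  have : IsManifold I (((⊤ : ℕ∞) : ℕ∞ω) + 1) M := inferInstanceAs (IsManifold I ∞ M)
  exact ContMDiffAt.mlieBracket_vectorField (m := ⊤) (n := ⊤) hX hY
    (by rw [minSmoothness_of_isRCLikeNormedField]; rfl)

lemma contMDiffAt_koszul {X Y Z : Π x : M, TangentSpace I x} {x : M}
    (hX : CMDiffAt ∞ (T% X) x) (hY : CMDiffAt ∞ (T% Y) x) (hZ : CMDiffAt ∞ (T% Z) x) :
    ContMDiffAt I 𝓘(ℝ) ∞ (koszul I X Y Z) x := by
  have h1 := contMDiffAt_mvfderiv_apply (contMDiffAt_inner hY hZ) hX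
  have h2 := contMDiffAt_mvfderiv_apply (contMDiffAt_inner hX hZ) hY
  have h3 := contMDiffAt_mvfderiv_apply (contMDiffAt_inner hX hY) hZ
  have h4 := contMDiffAt_inner (contMDiffAt_mlieBracket hX hY) hZ
  have h5 := contMDiffAt_inner (contMDiffAt_mlieBracket hX hZ) hY
  have h6 := contMDiffAt_inner (contMDiffAt_mlieBracket hY hZ) hX
  exact contMDiffAt_const.mul (((((h1.add h2).sub h3).add h4).sub h5).sub h6)

lemma eventually_mdifferentiableAt {X : Π x : M, TangentSpace I x} {x : M}
    (hX : CMDiffAt ∞ (T% X) x) : ∀ᶠ y in 𝓝 x, MDiffAt (T% X) y := by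
  have h : CMDiffAt 1 (T% X) x := ContMDiffAt.of_le hX (by simp)
  exact (((contMDiffAt_iff_contMDiffAt_nhds (by simp)).1 h)).mono
    fun _ h ↦ h.mdifferentiableAt one_ne_zero

/-- If `X` and `Y` are smooth at `x`, then so is `∇_X Y`. -/
lemma contMDiffAt_nabla {X Y : Π x : M, TangentSpace I x} {x : M}
    (hX : CMDiffAt ∞ (T% X) x) (hY : CMDiffAt ∞ (T% Y) x) :
    CMDiffAt ∞ (T% (nabla I X Y)) x := by
  refine contMDiffAt_of_inner fun Z hZ ↦ (contMDiffAt_koszul hX hY hZ).congr_of_eventuallyEq ?_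
  filter_upwards [eventually_mdifferentiableAt hX, eventually_mdifferentiableAt hY,
    eventually_mdifferentiableAt hZ] with y h1 h2 h3
  rw [real_inner_comm]
  exact inner_leviCivita h1 h2 h3

/-- The extension of a tangent vector at `x` given by `FiberBundle.extend` agrees near `x` with a
smooth vector field. -/
lemma exists_isSmoothField_eventuallyEq_extend [T2Space M] {x : M} (v : TangentSpace I x) :
    ∃ Z : Π x : M, TangentSpace I x, IsSmoothField I Z ∧
      ∀ᶠ y in 𝓝 x, Z y = FiberBundle.extend E v y := by
  obtain ⟨s, hs, hsv⟩ := FiberBundle.exists_contMDiffOn_extend (k := ∞) I E v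
  obtain ⟨u, hus, hu, hxu⟩ := mem_nhds_iff.1 hs
  obtain ⟨ψ, hψ⟩ : ∃ ψ : SmoothBumpFunction I x, tsupport ψ ⊆ u :=
    ((SmoothBumpFunction.nhds_basis_tsupport (I := I) x).mem_iff.1 (hu.mem_nhds hxu)).imp
      fun _ h ↦ h.2
  refine ⟨(ψ : M → ℝ) • FiberBundle.extend E v,
    ContMDiffOn.smul_section_of_tsupport ψ.contMDiff.contMDiffOn hu hψ (hsv.mono hus), ?_⟩
  filter_upwards [ψ.eventuallyEq_one] with y hy
  rw [Pi.smul_apply', hy, Pi.one_apply, one_smul]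

/-- Every tangent vector is the value of a smooth vector field. -/
lemma exists_isSmoothField_apply_eq [T2Space M] {x : M} (v : TangentSpace I x) :
    ∃ Z : Π x : M, TangentSpace I x, IsSmoothField I Z ∧ Z x = v := by
  obtain ⟨Z, hZ, h⟩ := exists_isSmoothField_eventuallyEq_extend v
  exact ⟨Z, hZ, by rw [h.self_of_nhds, FiberBundle.extend_apply_self]⟩

/-! ### Contact metric manifolds -/

lemma IsSmoothField.mdifferentiableAt {X : Π x : M, TangentSpace I x} (hX : IsSmoothField I X)
    (x : M) : MDiffAt (T% X) x :=
  (hX x).mdifferentiableAt (by simp)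

lemma IsSmoothField.nabla {X Y : Π x : M, TangentSpace I x} (hX : IsSmoothField I X)
    (hY : IsSmoothField I Y) : IsSmoothField I (nabla I X Y) :=
  fun x ↦ contMDiffAt_nabla (hX x) (hY x)

lemma IsSmoothField.const_smul {X : Π x : M, TangentSpace I x} (hX : IsSmoothField I X) (a : ℝ) :
    IsSmoothField I (a • X) :=
  ContMDiff.const_smul_section hX

lemma curvature_right_zero (X Y : Π x : M, TangentSpace I x) : curvature I X Y 0 = 0 := by
  have h : ∀ Z : Π x : M, TangentSpace I x, nabla I Z 0 = 0 := fun Z ↦ by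
    funext x
    simp [nabla]
  simp [curvature, h]

namespace IsAlmostContactMetric

variable {φ : Π x : M, TangentSpace I x →L[ℝ] TangentSpace I x}
  {ξ : Π x : M, TangentSpace I x} {η : Π x : M, TangentSpace I x →L[ℝ] ℝ}

lemma isAlmostContactLinear (h : IsAlmostContactMetric I φ ξ η) (x : M) :
    IsAlmostContactLinear (φ x) (ξ x) (η x) :=
  ⟨h.phi_sq x, h.eta_xi x, h.inner_phi x⟩

lemma isSmoothField_phi (h : IsAlmostContactMetric I φ ξ η) {X : Π x : M, TangentSpace I x}
    (hX : IsSmoothField I X) : IsSmoothField I fun x ↦ φ x (X x) :=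
  ContMDiff.clm_bundle_apply (F₁ := E) (F₂ := E) (b := fun x ↦ x) h.smooth_phi hX

end IsAlmostContactMetric

namespace IsContactMetric

variable {φ : Π x : M, TangentSpace I x →L[ℝ] TangentSpace I x}
  {ξ : Π x : M, TangentSpace I x} {η : Π x : M, TangentSpace I x →L[ℝ] ℝ}

lemma inner_leviCivita_xi_sub [T2Space M] (h : IsContactMetric I φ ξ η) (x : M)
    (v w : TangentSpace I x) :
    (inner ℝ (leviCivita I M ξ x v) w : ℝ) - inner ℝ (leviCivita I M ξ x w) v =
      2 * inner ℝ v (φ x w) := by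
  obtain ⟨X, hX, rfl⟩ := exists_isSmoothField_apply_eq v
  obtain ⟨Y, hY, rfl⟩ := exists_isSmoothField_apply_eq w
  have hξ := h.smooth_xi.mdifferentiableAt x
  have hη : ∀ y v, η y v = inner ℝ v (ξ y) := fun y v ↦ (h.isAlmostContactLinear y).eta_eq_inner v
  have h1 := h.deriv_eta X Y hX hY x
  have hX' := hX.mdifferentiableAt x
  have hY' := hY.mdifferentiableAt x
  simp only [oneFormDeriv, hη, leviCivita_metric hX' hY' hξ, leviCivita_metric hY' hX' hξ,
    ← leviCivita_torsion_free hX' hY', inner_sub_left] at h1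
  rw [← h1, real_inner_comm (Y x), real_inner_comm (X x)]
  ring

lemma inner_leviCivita_xi_xi [T2Space M] (h : IsContactMetric I φ ξ η) (x : M)
    (v : TangentSpace I x) : (inner ℝ (leviCivita I M ξ x v) (ξ x) : ℝ) = 0 := by
  obtain ⟨X, hX, rfl⟩ := exists_isSmoothField_apply_eq v
  have hξ := h.smooth_xi.mdifferentiableAt x
  have h1 := leviCivita_metric (hX.mdifferentiableAt x) hξ hξ
  have h2 : (fun y ↦ (inner ℝ (ξ y) (ξ y) : ℝ)) = fun _ ↦ 1 := by
    funext y
    rw [← (h.isAlmostContactLinear y).eta_eq_inner, h.eta_xi]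
  rw [h2, mvfderiv_const, real_inner_comm _ (ξ x)] at h1
  simp at h1
  linarith

lemma leviCivita_xi_xi [T2Space M] (h : IsContactMetric I φ ξ η) (x : M) :
    leviCivita I M ξ x (ξ x) = 0 := by
  refine ext_inner_right ℝ fun w ↦ ?_
  have h1 := h.inner_leviCivita_xi_sub x (ξ x) w
  have hL := h.isAlmostContactLinear x
  rw [h.inner_leviCivita_xi_xi, real_inner_comm (φ x w), ← hL.eta_eq_inner, hL.eta_phi] at h1
  rw [inner_zero_left]
  linarith

/-- Under the `(G3)` identity, `R_{Xξ}ξ = X - η(X)ξ`. -/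
lemma curvature_xi_xi [T2Space M] (h : IsContactMetric I φ ξ η) (hG3 : SatisfiesG3 I φ η)
    {X : Π x : M, TangentSpace I x} (hX : IsSmoothField I X) (x : M) :
    curvature I X ξ ξ x = X x - η x (X x) • ξ x := by
  have hL := h.isAlmostContactLinear
  refine ext_inner_right ℝ fun w ↦ ?_
  obtain ⟨W, hW, rfl⟩ := exists_isSmoothField_apply_eq w
  have h1 := hG3 X ξ ξ W hX h.smooth_xi h.smooth_xi hW x
  have h0 : (fun y ↦ φ y (ξ y)) = 0 := funext fun y ↦ (hL y).phi_xi
  simp only [riemannTensor, h0, curvature_right_zero, Pi.zero_apply, inner_zero_left,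
    h.eta_xi] at h1
  rw [← (hL x).eta_eq_inner (X x), ← (hL x).eta_eq_inner (ξ x), h.eta_xi,
    real_inner_comm (W x) (ξ x), ← (hL x).eta_eq_inner (W x)] at h1
  rw [inner_sub_left, real_inner_smul_left, real_inner_comm, real_inner_comm (W x) (ξ x),
    ← (hL x).eta_eq_inner (W x), real_inner_comm]
  linarith

lemma curvature_xi_xi_eq [T2Space M] (h : IsContactMetric I φ ξ η)
    {X : Π x : M, TangentSpace I x} {x : M} (hX : MDiffAt (T% X) x) :
    curvature I X ξ ξ x = leviCivita I M ξ x (leviCivita I M X x (ξ x)) -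
      leviCivita I M ξ x (leviCivita I M ξ x (X x)) - leviCivita I M (nabla I X ξ) x (ξ x) := by
  have h0 : nabla I ξ ξ = 0 := funext h.leviCivita_xi_xi
  have h1 : nabla I X 0 x = 0 := by simp [nabla]
  rw [curvature, h0, Pi.sub_apply, Pi.sub_apply, h1]
  simp only [nabla]
  rw [← leviCivita_torsion_free hX (h.smooth_xi.mdifferentiableAt x), map_sub]
  abel

/-- The covariant derivative of `∇ξ` along `ξ`. -/
lemma leviCivita_nabla_xi [T2Space M] (h : IsContactMetric I φ ξ η) (hG3 : SatisfiesG3 I φ η)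
    {X : Π x : M, TangentSpace I x} (hX : IsSmoothField I X) (x : M) :
    leviCivita I M (nabla I X ξ) x (ξ x) = leviCivita I M ξ x (leviCivita I M X x (ξ x)) -
      leviCivita I M ξ x (leviCivita I M ξ x (X x)) + φ x (φ x (X x)) := by
  have h1 := h.curvature_xi_xi_eq (hX.mdifferentiableAt x)
  rw [h.curvature_xi_xi hG3 hX] at h1
  rw [h.phi_sq, neg_add_eq_sub, ← neg_sub (X x), h1]
  abel

lemma curvature_extend_xi_xi [T2Space M] (h : IsContactMetric I φ ξ η)
    (hG3 : SatisfiesG3 I φ η) {x : M} (v : TangentSpace I x) :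
    curvature I (FiberBundle.extend E v) ξ ξ x = v - η x v • ξ x := by
  obtain ⟨Z, hZ, hZv⟩ := exists_isSmoothField_eventuallyEq_extend v
  have hv : CMDiffAt ∞ (T% (FiberBundle.extend E v)) x := FiberBundle.contMDiffAt_extend ..
  have hv' : MDiffAt (T% (FiberBundle.extend E v)) x := hv.mdifferentiableAt (by simp)
  have hx : Z x = v := by rw [hZv.self_of_nhds, FiberBundle.extend_apply_self]
  have h1 : leviCivita I M (FiberBundle.extend E v) x = leviCivita I M Z x :=
    (leviCivita I M).isCovariantDerivativeOn.congr_of_eventuallyEq hv' (hZ.mdifferentiableAt x)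
      Filter.univ_mem (hZv.mono fun _ h ↦ h.symm)
  have h2 : leviCivita I M (nabla I (FiberBundle.extend E v) ξ) x =
      leviCivita I M (nabla I Z ξ) x :=
    (leviCivita I M).isCovariantDerivativeOn.congr_of_eventuallyEq
      ((contMDiffAt_nabla hv (h.smooth_xi x)).mdifferentiableAt (by simp))
      ((hZ.nabla h.smooth_xi).mdifferentiableAt x) Filter.univ_mem
      (hZv.mono fun y hy ↦ by rw [nabla, nabla, hy])
  have h3 := h.curvature_xi_xi hG3 hZ x
  rw [h.curvature_xi_xi_eq (hZ.mdifferentiableAt x), hx] at h3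
  rw [h.curvature_xi_xi_eq hv', h1, h2, FiberBundle.extend_apply_self, h3]

/-- The symmetric part of `∇ξ`, whose skew part is `-φ`. -/
def symmetricPart (φ : Π x : M, TangentSpace I x →L[ℝ] TangentSpace I x)
    (ξ : Π x : M, TangentSpace I x) (x : M) : TangentSpace I x →L[ℝ] TangentSpace I x :=
  leviCivita I M ξ x + φ x

lemma leviCivita_xi_eq (x : M) (v : TangentSpace I x) :
    leviCivita I M ξ x v = symmetricPart φ ξ x v - φ x v := by
  rw [symmetricPart, add_apply, add_sub_cancel_right]

lemma inner_symmetricPart_left [T2Space M] (h : IsContactMetric I φ ξ η) (x : M)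
    (v w : TangentSpace I x) :
    (inner ℝ (symmetricPart φ ξ x v) w : ℝ) = inner ℝ v (symmetricPart φ ξ x w) := by
  have h1 := h.inner_leviCivita_xi_sub x v w
  rw [symmetricPart, add_apply, add_apply, inner_add_left, inner_add_right,
    (h.isAlmostContactLinear x).inner_phi_left, real_inner_comm (leviCivita I M ξ x w) v]
  linarith

lemma symmetricPart_xi [T2Space M] (h : IsContactMetric I φ ξ η) (x : M) :
    symmetricPart φ ξ x (ξ x) = 0 := by
  rw [symmetricPart, add_apply, h.leviCivita_xi_xi, (h.isAlmostContactLinear x).phi_xi, add_zero]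

lemma leviCivita_phi_sub [T2Space M] (h : IsContactMetric I φ ξ η) (hG3 : SatisfiesG3 I φ η)
    {Y : Π x : M, TangentSpace I x} (hY : IsSmoothField I Y) (x : M) :
    leviCivita I M (fun y ↦ φ y (Y y)) x (ξ x) - φ x (leviCivita I M Y x (ξ x)) =
      -(symmetricPart φ ξ x (φ x (Y x)) + φ x (symmetricPart φ ξ x (Y x))) := by
  have hL := h.isAlmostContactLinear x
  refine hL.eq_neg_anticommutator (h.inner_symmetricPart_left x) (leviCivita_xi_eq x) fun v ↦ ?_
  obtain ⟨X, hX, rfl⟩ := exists_isSmoothField_apply_eq v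
  have hξ := h.smooth_xi
  have hξ' := hξ.mdifferentiableAt x
  have hX' := hX.mdifferentiableAt x
  have hY' := hY.mdifferentiableAt x
  have hAX := (hX.nabla hξ).mdifferentiableAt x
  have hAY := (hY.nabla hξ).mdifferentiableAt x
  have hφY := (h.isSmoothField_phi hY).mdifferentiableAt x
  have h0 : (fun y ↦ (inner ℝ (nabla I X ξ y) (Y y) : ℝ)) = fun y ↦
      (inner ℝ (nabla I Y ξ y) (X y) : ℝ) +
        ((inner ℝ (X y) (φ y (Y y)) : ℝ) + (inner ℝ (X y) (φ y (Y y)) : ℝ)) := by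
    funext y
    have := h.inner_leviCivita_xi_sub y (X y) (Y y)
    simp only [nabla]
    linarith
  have h1 := congrArg (fun f ↦ mvfderiv I f x (ξ x)) h0
  have hd := mdifferentiableAt_inner hX' hφY
  have hd2 : MDiffAt (fun y ↦ (inner ℝ (X y) (φ y (Y y)) : ℝ) + inner ℝ (X y) (φ y (Y y))) x :=
    hd.add hd
  rw [mvfderiv_fun_add (mdifferentiableAt_inner hAY hX') hd2, mvfderiv_fun_add hd hd,
    add_apply, add_apply, leviCivita_metric hξ' hAX hY', leviCivita_metric hξ' hAY hX',
    leviCivita_metric hξ' hX' hφY, h.leviCivita_nabla_xi hG3 hX, h.leviCivita_nabla_xi hG3 hY] at h1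
  have h2 := h.inner_leviCivita_xi_sub x (X x) (leviCivita I M Y x (ξ x))
  have h3 := h.inner_leviCivita_xi_sub x (leviCivita I M X x (ξ x)) (Y x)
  simp only [inner_add_left, inner_sub_left, nabla, hL.inner_phi_phi_left (X x)] at h1
  rw [real_inner_comm (φ x (φ x (Y x))) (X x)] at h1
  rw [inner_sub_right]
  linarith

lemma symmetricPart_anticomm [T2Space M] (h : IsContactMetric I φ ξ η) (hG3 : SatisfiesG3 I φ η)
    (x : M) (v : TangentSpace I x) :
    symmetricPart φ ξ x (φ x v) + φ x (symmetricPart φ ξ x v) = 0 := by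
  have hL := h.isAlmostContactLinear
  refine (hL x).anticommutator_eq_zero (h.inner_symmetricPart_left x) (h.symmetricPart_xi x)
    (fun y ↦ ?_) v
  obtain ⟨Y, hY, rfl⟩ := exists_isSmoothField_apply_eq y
  have hφY := h.isSmoothField_phi hY
  have h1 := h.leviCivita_phi_sub hG3 hY x
  have h2 := h.leviCivita_phi_sub hG3 hφY x
  have hξ' := h.smooth_xi.mdifferentiableAt x
  have hY' := hY.mdifferentiableAt x
  have h3 : leviCivita I M (fun y ↦ φ y (φ y (Y y))) x (ξ x) =
      φ x (φ x (leviCivita I M Y x (ξ x))) := by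
    have hf : MDiffAt (fun y ↦ (inner ℝ (Y y) (ξ y) : ℝ)) x := mdifferentiableAt_inner hY' hξ'
    have h4 : (fun y ↦ φ y (φ y (Y y))) =
        ((-1 : ℝ) • Y) + (fun y ↦ (inner ℝ (Y y) (ξ y) : ℝ)) • ξ := by
      funext y
      rw [h.phi_sq, (hL y).eta_eq_inner]
      simp
    have hcov := (leviCivita I M).isCovariantDerivativeOnUniv
    rw [h4, hcov.add ((hY.const_smul (-1)).mdifferentiableAt x) (hf.smul_section hξ'),
      hcov.smul_const _ hY', hcov.leibniz hξ' hf, h.phi_sq, (hL x).eta_eq_inner]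
    rw [add_apply, add_apply, smul_apply, smul_apply, h.leviCivita_xi_xi, smul_zero, zero_add,
      ContinuousLinearMap.smulRight_apply, leviCivita_metric hξ' hY' hξ', h.leviCivita_xi_xi,
      inner_zero_right, add_zero, neg_one_smul]
  rw [h3] at h2
  have h5 : symmetricPart φ ξ x (φ x (Y x)) + φ x (symmetricPart φ ξ x (Y x)) =
      -(leviCivita I M (fun y ↦ φ y (Y y)) x (ξ x) - φ x (leviCivita I M Y x (ξ x))) := by
    rw [h1, neg_neg]
  rw [h5, map_neg, neg_neg, map_sub, ← neg_inj, ← h2, neg_sub]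

/-- `∇_ξ φ = 0`. -/
lemma leviCivita_phi [T2Space M] (h : IsContactMetric I φ ξ η) (hG3 : SatisfiesG3 I φ η)
    {X : Π x : M, TangentSpace I x} (hX : IsSmoothField I X) (x : M) :
    leviCivita I M (fun y ↦ φ y (X y)) x (ξ x) = φ x (leviCivita I M X x (ξ x)) := by
  have h1 := h.leviCivita_phi_sub hG3 hX x
  rwa [h.symmetricPart_anticomm hG3, neg_zero, sub_eq_zero] at h1

lemma symmetricPart_eq_zero [T2Space M] (h : IsContactMetric I φ ξ η) (hG3 : SatisfiesG3 I φ η)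
    (x : M) (v : TangentSpace I x) : symmetricPart φ ξ x v = 0 := by
  have hL := h.isAlmostContactLinear
  refine (hL x).symmetricPart_eq_zero (h.inner_symmetricPart_left x) (h.symmetricPart_xi x)
    (leviCivita_xi_eq x) (h.symmetricPart_anticomm hG3 x) (fun y ↦ ?_) v
  obtain ⟨Y, hY, rfl⟩ := exists_isSmoothField_apply_eq y
  have hφY := h.isSmoothField_phi hY
  have hAY := hY.nabla h.smooth_xi
  have hanti : ∀ y (w : TangentSpace I y), leviCivita I M ξ y (φ y w) =
      -φ y (leviCivita I M ξ y w) + (-2 : ℝ) • φ y (φ y w) := fun y w ↦ by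
    have h1 := h.symmetricPart_anticomm hG3 y w
    simp only [symmetricPart, add_apply, map_add] at h1
    rw [← sub_eq_zero, ← h1]
    module
  have h0 : nabla I (fun y ↦ φ y (Y y)) ξ =
      ((-1 : ℝ) • fun y ↦ φ y (nabla I Y ξ y)) + (-2 : ℝ) • fun y ↦ φ y (φ y (Y y)) := by
    funext y
    simp [nabla, hanti]
  have hcov := (leviCivita I M).isCovariantDerivativeOnUniv
  have h1 := (h.isSmoothField_phi hAY).mdifferentiableAt x
  have h2 := (h.isSmoothField_phi hφY).mdifferentiableAt x
  have h3 := h.leviCivita_nabla_xi hG3 hφY x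
  rw [h0, hcov.add (((h.isSmoothField_phi hAY).const_smul (-1)).mdifferentiableAt x)
    (((h.isSmoothField_phi hφY).const_smul (-2)).mdifferentiableAt x), hcov.smul_const _ h1, hcov.smul_const _ h2, add_apply,
    smul_apply, smul_apply, h.leviCivita_phi hG3 hAY, h.leviCivita_phi hG3 hφY,
    h.leviCivita_phi hG3 hY, h.leviCivita_nabla_xi hG3 hY, hanti, (hL x).phi_phi_phi] at h3
  simp only [map_add, map_sub, (hL x).phi_phi_phi] at h3
  rw [← sub_eq_zero] at h3 ⊢
  rw [← h3]
  module

/-- A contact metric manifold satisfying the `(G3)` identity is K-contact. -/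
theorem isKContact_of_satisfiesG3 [T2Space M] (h : IsContactMetric I φ ξ η)
    (hG3 : SatisfiesG3 I φ η) : IsKContact I φ ξ η where
  toIsContactMetric := h
  isKilling X Y hX hY x := by
    have hξ := h.smooth_xi.mdifferentiableAt x
    have hX' := hX.mdifferentiableAt x
    have hY' := hY.mdifferentiableAt x
    rw [lieDerivMetric, leviCivita_metric hξ hX' hY', ← leviCivita_torsion_free hξ hX',
      ← leviCivita_torsion_free hξ hY', leviCivita_xi_eq (φ := φ) (ξ := ξ),
      leviCivita_xi_eq (φ := φ) (ξ := ξ),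
      h.symmetricPart_eq_zero hG3, h.symmetricPart_eq_zero hG3]
    simp only [inner_sub_left, inner_sub_right, inner_zero_left, inner_zero_right,
      (h.isAlmostContactLinear x).inner_phi_left]
    ring

theorem ricci_xi_xi [T2Space M] (h : IsContactMetric I φ ξ η) (hG3 : SatisfiesG3 I φ η) (x : M) :
    ricci I ξ ξ x = (Module.finrank ℝ E : ℝ) - 1 := by
  have hL := h.isAlmostContactLinear x
  set b := stdOrthonormalBasis ℝ (TangentSpace I x)
  have h1 : ∀ i, (inner ℝ (b i - η x (b i) • ξ x) (b i) : ℝ) =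
      1 - inner ℝ (ξ x) (b i) * inner ℝ (b i) (ξ x) := fun i ↦ by
    rw [inner_sub_left, real_inner_smul_left, real_inner_self_eq_norm_sq, b.norm_eq_one,
      hL.eta_eq_inner]
    ring
  simp only [ricci, h.curvature_extend_xi_xi hG3]
  rw [Finset.sum_congr rfl fun i _ ↦ h1 i, Finset.sum_sub_distrib, b.sum_inner_mul_inner,
    ← hL.eta_eq_inner, hL.eta_xi]
  simp
  rfl

end IsContactMetric

end ContactGeometry

end

theorem mainTheorem6 (n : ℕ)
    {M : Type*} [TopologicalSpace M] [T2Space M] [SecondCountableTopology M]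
    [ChartedSpace (EuclideanSpace ℝ (Fin (2 * n + 1))) M] [IsManifold (𝓡 (2 * n + 1)) ∞ M]
    [RiemannianBundle (fun x : M ↦ TangentSpace (𝓡 (2 * n + 1)) x)]
    [IsContMDiffRiemannianBundle (𝓡 (2 * n + 1)) ∞ (EuclideanSpace ℝ (Fin (2 * n + 1)))
      (fun x : M ↦ TangentSpace (𝓡 (2 * n + 1)) x)]
    (φ : Π x : M, TangentSpace (𝓡 (2 * n + 1)) x →L[ℝ] TangentSpace (𝓡 (2 * n + 1)) x)
    (ξ : Π x : M, TangentSpace (𝓡 (2 * n + 1)) x)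
    (η : Π x : M, TangentSpace (𝓡 (2 * n + 1)) x →L[ℝ] ℝ)
    (hcontact : ContactGeometry.IsContactMetric (𝓡 (2 * n + 1)) φ ξ η)
    (hG3 : ContactGeometry.SatisfiesG3 (𝓡 (2 * n + 1)) φ η) :
    (∀ x : M, ContactGeometry.ricci (𝓡 (2 * n + 1)) ξ ξ x = 2 * (n : ℝ)) ∧
      ContactGeometry.IsKContact (𝓡 (2 * n + 1)) φ ξ η := by
  refine ⟨fun x ↦ ?_, hcontact.isKContact_of_satisfiesG3 hG3⟩
  rw [hcontact.ricci_xi_xi hG3, finrank_euclideanSpace_fin]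
  push_cast
  ring
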